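/- Fix $d\ge 2$ and the Hilbert space $\mathcal H=\mathbb C^d$ with its computational basis, let $m$ be a non-negative integer, and for a unit vector $|\psi\rangle=\sum_i\psi_i|i\rangle$ write $|\psi^*\rangle=\sum_i\overline{\psi_i}|i\rangle$. Let $\mathcal S(\mathcal H)$ be the set of density operators on $\mathcal H$. A state transformation $T:\mathcal S(\mathcal H)\to\mathcal S(\mathcal H)$ is called probabilistically implementable from $m$ clones if there are $\epsilon>0$ and a quantum instrument $\{\mathcal E,\mathcal E'\}$ from $\mathcal H^{\otimes m}$ to $\mathcal H$ (i.e. completely positive linear maps $\mathcal E,\mathcal E':\mathcal B(\mathcal H^{\otimes m})\to\mathcal B(\mathcal H)$ with $\mathcal E+\mathcal E'$ trace preserving) such that, for every unit vector $|\psi\rangle\in\mathcal H$, $\mathcal E(|\psi\rangle\langle\psi|^{\otimes m})$ is a scalar multiple of $T(|\psi\rangle\langle\psi|)$ and $\operatorname{Tr}\,\mathcal E(|\psi\rangle\langle\psi|^{\otimes m})\ge\epsilon$. Theorem. For every $d\ge2$ and every $m$, state conjugation $\rho\mapsto\rho^*$ (entrywise complex conjugation in the computational basis, so that $|\psi\rangle\langle\psi|\mapsto|\psi^*\rangle\langle\psi^*|$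 on pure states) is not probabilistically implementable from $m$ clones. -/

import Mathlib

open scoped CStarAlgebra ComplexOrder

noncomputable section

/-- The C⋆-algebra `B(ℂ^ι)` of operators on the Hilbert space with orthonormal basis indexed
by the finite type `ι`, written as matrices in that (computational) basis. -/
abbrev Op (ι : Type) [Fintype ι] [DecidableEq ι] : Type := CStarMatrix ι ι ℂ

/-- The trace of an operator. -/
def Op.tr {ι : Type} [Fintype ι] [DecidableEq ι] (X : Op ι) : ℂ := ∑ i, X i i

/-- The set of states (density operators) on `ℂ^d`: positive operators of trace one. -/
def State (d : ℕ) : Type := {ρ : Op (Fin d) // 0 ≤ ρ ∧ ρ.tr = 1}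

/-- The operator `|ψ⟩⟨ψ|`, with matrix entries `ψ i * conj (ψ j)`. -/
def ketbra {d : ℕ} (ψ : EuclideanSpace ℂ (Fin d)) : Op (Fin d) :=
  CStarMatrix.ofMatrix (Matrix.of fun i j => ψ i * star (ψ j))

theorem ketbra_nonneg {d : ℕ} (ψ : EuclideanSpace ℂ (Fin d)) : 0 ≤ ketbra ψ := by
  have h : ketbra ψ = star (CStarMatrix.ofMatrix (Matrix.of fun (i j : Fin d) =>
      if i.val = 0 then star (ψ j) else 0) : Op (Fin d)) *
      (CStarMatrix.ofMatrix (Matrix.of fun (i j : Fin d) =>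
      if i.val = 0 then star (ψ j) else 0) : Op (Fin d)) := by
    ext i j
    have hd : 0 < d := i.pos
    rw [CStarMatrix.mul_apply, Finset.sum_eq_single (⟨0, hd⟩ : Fin d)]
    · simp [ketbra, CStarMatrix.star_apply]
    · intro k _ hk
      have : k.val ≠ 0 := fun h0 => hk (Fin.ext h0)
      simp [this]
    · simp
  rw [h]
  exact star_mul_self_nonneg _

theorem ketbra_tr {d : ℕ} (ψ : EuclideanSpace ℂ (Fin d)) (hψ : ‖ψ‖ = 1) : (ketbra ψ).tr = 1 := by
  have h := EuclideanSpace.norm_sq_eq ψ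
  have h2 : (ketbra ψ).tr = ((∑ i, ‖ψ i‖ ^ 2 : ℝ) : ℂ) := by
    simp [Op.tr, ketbra, Complex.mul_conj, Complex.normSq_eq_norm_sq]
  rw [h2, ← h, hψ]
  simp

/-- The pure state `|ψ⟩⟨ψ|` of a unit vector `ψ`. -/
def State.pure {d : ℕ} (ψ : EuclideanSpace ℂ (Fin d)) (hψ : ‖ψ‖ = 1) : State d :=
  ⟨ketbra ψ, ketbra_nonneg ψ, ketbra_tr ψ hψ⟩

/-- The tensor power `X^{⊗ m}` of an operator `X` on `ℂ^d`, acting on `(ℂ^d)^{⊗ m}`, whose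
orthonormal product basis is indexed by the functions `Fin m → Fin d`. -/
def tensorPow {d : ℕ} (m : ℕ) (X : Op (Fin d)) : Op (Fin m → Fin d) :=
  CStarMatrix.ofMatrix (Matrix.of fun i j => ∏ k, X (i k) (j k))

/-- A two-outcome quantum instrument `{E, E'}` from `B(ℂ^ι)` to `B(ℂ^κ)`: two completely positive
maps whose sum is trace preserving. -/
structure Instrument (ι κ : Type) [Fintype ι] [DecidableEq ι] [Fintype κ] [DecidableEq κ] where
  success : Op ι →CP Op κ
  failure : Op ι →CP Op κ
  tracePreserving : ∀ X : Op ι, (success X + failure X).tr = X.tr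

/-- A state transformation `T` is probabilistically implementable from `m` clones if some
instrument, for every pure input state `|ψ⟩⟨ψ|^{⊗ m}`, outputs in its success branch (a multiple
of) `T(|ψ⟩⟨ψ|)`, with success probability at least some `ε > 0` independent of `ψ`. -/
def ProbabilisticallyImplementable {d : ℕ} (T : State d → State d) (m : ℕ) : Prop :=
  ∃ ε : ℝ, 0 < ε ∧ ∃ I : Instrument (Fin m → Fin d) (Fin d),
    ∀ (ψ : EuclideanSpace ℂ (Fin d)) (hψ : ‖ψ‖ = 1),
      (∃ c : ℂ, I.success (tensorPow m (State.pure ψ hψ).1) = c • (T (State.pure ψ hψ)).1) ∧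
      ε ≤ (I.success (tensorPow m (State.pure ψ hψ).1)).tr.re

/-- Entrywise complex conjugation of an operator in the computational basis. -/
def Op.conj {ι : Type} [Fintype ι] [DecidableEq ι] (X : Op ι) : Op ι := X.map star

theorem Op.conj_nonneg {ι : Type} [Fintype ι] [DecidableEq ι] {X : Op ι} (hX : 0 ≤ X) :
    0 ≤ X.conj := by
  rw [StarOrderedRing.nonneg_iff] at hX ⊢
  induction hX using AddSubmonoid.closure_induction with
  | mem x hx =>
    obtain ⟨y, rfl⟩ := hx
    refine AddSubmonoid.subset_closure ⟨y.conj, ?_⟩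
    ext i j
    simp [Op.conj, CStarMatrix.mul_apply, CStarMatrix.star_apply]
  | zero =>
    have h : (0 : Op ι).conj = 0 := by ext i j; simp [Op.conj]
    rw [h]
    exact zero_mem _
  | add x y _ _ hx hy =>
    have h : (x + y).conj = x.conj + y.conj := by ext i j; simp [Op.conj]
    rw [h]
    exact add_mem hx hy

/-- State conjugation `ρ ↦ ρ*` with respect to the computational basis. -/
def State.conj {d : ℕ} (ρ : State d) : State d :=
  ⟨ρ.1.conj, Op.conj_nonneg ρ.2.1, by
    have h : ρ.1.conj.tr = star ρ.1.tr := by simp [Op.tr, Op.conj]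
    rw [h, ρ.2.2, star_one]⟩

/-- The vector `|ψ*⟩` with complex conjugate coordinates. -/
def conjVec {d : ℕ} (ψ : EuclideanSpace ℂ (Fin d)) : EuclideanSpace ℂ (Fin d) :=
  WithLp.toLp 2 fun i => star (ψ i)

theorem norm_conjVec {d : ℕ} (ψ : EuclideanSpace ℂ (Fin d)) : ‖conjVec ψ‖ = ‖ψ‖ := by
  simp [EuclideanSpace.norm_eq, conjVec]

/-- On pure states, state conjugation is `|ψ⟩⟨ψ| ↦ |ψ*⟩⟨ψ*|`. -/
theorem State.conj_pure {d : ℕ} (ψ : EuclideanSpace ℂ (Fin d)) (hψ : ‖ψ‖ = 1) :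
    (State.pure ψ hψ).conj = State.pure (conjVec ψ) ((norm_conjVec ψ).trans hψ) := by
  apply Subtype.ext
  ext i j
  simp [State.conj, State.pure, Op.conj, ketbra, conjVec]

end

/-! A completely positive `E` is linear in the ket of `|u⟩⟨w|`, while conjugation is antilinear. By
positivity on 2×2 blocks, the range of `E(|u⟩⟨w|)` lies in that of `E(|u⟩⟨u|)`
(`CompletelyPositiveMap.outer_row_eq_zero`). For `ψ_t = e₀ + t e₁` the first column of
`E(|ψ_t^{⊗m}⟩⟨ψ_0^{⊗m}|)` is therefore a multiple of `ψ_t*`, so its first two entries satisfy `Q(t)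
= conj t * P(t)`. Both are polynomials in `t`, which forces `P = 0`. But `P(0)` is the success
probability on `e₀`. -/

open Polynomial in
theorem Polynomial.eq_zero_of_eval_eq_conj_mul {p q : ℂ[X]}
    (h : ∀ t : ℂ, q.eval t = star t * p.eval t) : p = 0 := by
  -- Compare on the real line, where `conj t = t`.
  have hq : q = X * p := by
    refine eq_of_infinite_eval_eq _ _ ?_
    refine (Set.infinite_range_of_injective Complex.ofReal_injective).mono ?_
    rintro _ ⟨x, rfl⟩
    simp [h]
  refine eq_zero_of_infinite_isRoot _ ?_
  -- On the imaginary axis `conj t = -t`, so `2 * t * p(t) = 0`; the shift by 1 avoids `t = 0`.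
  have hinj : Function.Injective fun n : ℕ => (1 + n : ℂ) * Complex.I := by
    intro a b hab
    simpa using hab
  refine (Set.infinite_range_of_injective hinj).mono ?_
  rintro _ ⟨n, rfl⟩
  have h1 := h ((1 + n : ℂ) * Complex.I)
  rw [hq] at h1
  simp only [eval_mul, eval_X, star_mul', star_add, star_one, star_natCast,
    Complex.star_def, Complex.conj_I] at h1
  have h2 : (2 * ((1 + n : ℂ) * Complex.I)) * p.eval ((1 + n : ℂ) * Complex.I) = 0 := by
    linear_combination h1
  have hn : (1 + n : ℂ) ≠ 0 := by
    rw [add_comm]; exact Nat.cast_add_one_ne_zero n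
  simpa [hn] using h2

/-- The rank-one operator `|u⟩⟨w|`. -/
def Op.outer {ι : Type} [Fintype ι] [DecidableEq ι] (u w : ι → ℂ) : Op ι :=
  CStarMatrix.ofMatrix (Matrix.of fun a b => u a * star (w b))

/-- The Gram block matrix with blocks `|u i⟩⟨u j|` is positive. -/
theorem Op.outer_block_nonneg {ι : Type} [Fintype ι] [DecidableEq ι] {n : ℕ}
    (u : Fin (n + 1) → ι → ℂ) (a₀ : ι) :
    0 ≤ (CStarMatrix.ofMatrix (Matrix.of fun i j => Op.outer (u i) (u j)) :
      CStarMatrix (Fin (n + 1)) (Fin (n + 1)) (Op ι)) := by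
  -- The row of bras `⟨u j|`, padded by zeros to a square matrix of operators.
  let R : CStarMatrix (Fin (n + 1)) (Fin (n + 1)) (Op ι) :=
    CStarMatrix.ofMatrix (Matrix.of fun k j => if k = 0 then
      CStarMatrix.ofMatrix (Matrix.of fun a b => if a = a₀ then star (u j b) else 0) else 0)
  have h : (CStarMatrix.ofMatrix (Matrix.of fun i j => Op.outer (u i) (u j)) :
      CStarMatrix (Fin (n + 1)) (Fin (n + 1)) (Op ι)) = star R * R := by
    ext i j a b
    rw [CStarMatrix.mul_apply, Finset.sum_eq_single (0 : Fin (n + 1)),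
      CStarMatrix.mul_apply, Finset.sum_eq_single a₀]
    · simp [R, Op.outer, CStarMatrix.star_apply]
    · intro c _ hc
      simp [R, hc]
    · simp
    · intro k _ hk
      simp [R, hk]
    · simp
  rw [h]
  exact star_mul_self_nonneg _

theorem CStarAlgebra.exists_eq_star_mul_self_of_nonneg {A : Type*} [NonUnitalCStarAlgebra A]
    [PartialOrder A] [StarOrderedRing A] {a : A} (ha : 0 ≤ a) : ∃ b, a = star b * b :=
  CStarAlgebra.nonneg_iff_eq_star_mul_self.mp ha

/-- A kernel vector of a diagonal block of a positive block matrix annihilates the block row. -/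
theorem Op.block_row_eq_zero {κ : Type} [Fintype κ] [DecidableEq κ] {n : ℕ}
    {N : CStarMatrix (Fin n) (Fin n) (Op κ)} (hN : 0 ≤ N) (i j : Fin n) (v : κ → ℂ)
    (hv : ∀ p, ∑ q, N i i p q * v q = 0) (r : κ) :
    ∑ p, star (v p) * N i j p r = 0 := by
  obtain ⟨Y, rfl⟩ := CStarAlgebra.exists_eq_star_mul_self_of_nonneg hN
  have entry (a b : Fin n) (p q : κ) :
      (star Y * Y) a b p q = ∑ k, ∑ s, star (Y k a s p) * Y k b s q := by
    have hs (A : Fin n → Op κ) : (∑ k, A k) p q = ∑ k, A k p q := by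
      exact Matrix.sum_apply p q _ _
    rw [CStarMatrix.mul_apply, hs]
    simp [CStarMatrix.mul_apply, CStarMatrix.star_apply]
  simp only [entry] at hv ⊢
  have pull (B : Fin n → κ → ℂ) :
      ∑ p, star (v p) * ∑ k, ∑ s, star (Y k i s p) * B k s
        = ∑ k, ∑ s, star (∑ p, Y k i s p * v p) * B k s := by
    simp only [star_sum, star_mul', Finset.sum_mul, Finset.mul_sum]
    rw [Finset.sum_comm]
    refine Finset.sum_congr rfl fun k _ => ?_
    rw [Finset.sum_comm]
    refine Finset.sum_congr rfl fun s _ => Finset.sum_congr rfl fun p _ => ?_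
    ring
  -- With `N = Y* Y` and `Y_i` its `i`-th block column, `⟨v, N_ii v⟩ = ‖Y_i v‖²`, hence `Y_i v = 0`.
  have hform : ∑ k, ∑ s, star (∑ p, Y k i s p * v p) * (∑ q, Y k i s q * v q) = 0 := by
    rw [← pull fun k s => ∑ q, Y k i s q * v q]
    refine Finset.sum_eq_zero fun p _ => ?_
    rw [← mul_zero (star (v p)), ← hv p]
    congr 1
    simp only [Finset.sum_mul, Finset.mul_sum]
    symm
    rw [Finset.sum_comm]
    refine Finset.sum_congr rfl fun k _ => ?_
    rw [Finset.sum_comm]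
    refine Finset.sum_congr rfl fun s _ => Finset.sum_congr rfl fun q _ => ?_
    ring
  have hY : ∀ k s, ∑ p, Y k i s p * v p = 0 := by
    intro k s
    have h0 : ∀ k s, 0 ≤ star (∑ p, Y k i s p * v p) * (∑ q, Y k i s q * v q) :=
      fun k s => star_mul_self_nonneg _
    have h1 := (Finset.sum_eq_zero_iff_of_nonneg
      fun k _ => Finset.sum_nonneg fun s _ => h0 k s).mp hform k (Finset.mem_univ _)
    have h2 := (Finset.sum_eq_zero_iff_of_nonneg fun s _ => h0 k s).mp h1 s (Finset.mem_univ _)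
    exact (mul_eq_zero.mp h2).elim star_eq_zero.mp id
  rw [pull fun k s => Y k j s r]
  simp only [hY, star_zero, zero_mul, Finset.sum_const_zero]

/-- A kernel vector of the image of `|u⟩⟨u|` under a completely positive map annihilates the
image of `|u⟩⟨w|`. -/
theorem CompletelyPositiveMap.outer_row_eq_zero {ι κ : Type} [Fintype ι] [DecidableEq ι]
    [Fintype κ] [DecidableEq κ] [Nonempty ι] (E : Op ι →CP Op κ) (u w : ι → ℂ) (v : κ → ℂ)
    (hv : ∀ p, ∑ q, E (Op.outer u u) p q * v q = 0) (r : κ) :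
    ∑ p, star (v p) * E (Op.outer u w) p r = 0 := by
  have h := E.map_cstarMatrix_nonneg' 2 _
    (Op.outer_block_nonneg (n := 1) ![u, w] (Classical.arbitrary ι))
  have h2 := Op.block_row_eq_zero h 0 1 v
  exact h2 hv r

/-- The coordinates of `ψ^{⊗ m}`. -/
def tensorVec {d : ℕ} (m : ℕ) (ψ : Fin d → ℂ) (a : Fin m → Fin d) : ℂ := ∏ k, ψ (a k)

theorem tensorPow_ketbra {d : ℕ} (m : ℕ) (ψ : EuclideanSpace ℂ (Fin d)) :
    tensorPow m (ketbra ψ) = Op.outer (tensorVec m ψ) (tensorVec m ψ) := by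
  ext a b
  simp [tensorPow, ketbra, Op.outer, tensorVec, Finset.prod_mul_distrib]

theorem ketbra_smul {d : ℕ} (c : ℂ) (ψ : EuclideanSpace ℂ (Fin d)) :
    ketbra (c • ψ) = (c * star c) • ketbra ψ := by
  ext i j
  simp [ketbra]
  ring

theorem tensorPow_smul {d : ℕ} (m : ℕ) (c : ℂ) (X : Op (Fin d)) :
    tensorPow m (c • X) = c ^ m • tensorPow m X := by
  ext a b
  simp [tensorPow, Finset.prod_mul_distrib]

/-- The entries of a linear image of `|u t⟩⟨w|` are polynomial in `t` if those of `u t` are. -/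
theorem exists_polynomial_map_outer {ι κ : Type} [Fintype ι] [DecidableEq ι]
    [Fintype κ] [DecidableEq κ] (E : Op ι →ₗ[ℂ] Op κ) (u : ι → Polynomial ℂ) (w : ι → ℂ)
    (p q : κ) :
    ∃ P : Polynomial ℂ, ∀ t, P.eval t = E (Op.outer (fun a => (u a).eval t) w) p q := by
  refine ⟨∑ a, u a * Polynomial.C (E (Op.outer (Pi.single a 1) w) p q), fun t => ?_⟩
  have h : Op.outer (fun a => (u a).eval t) w
      = ∑ a, (u a).eval t • Op.outer (Pi.single a 1) w := by
    ext i j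
    have hs (A : ι → Op ι) : (∑ k, A k) i j = ∑ k, A k i j := by
      exact Matrix.sum_apply i j _ _
    rw [hs]
    simp [Op.outer, Pi.single_apply]
  have hs (A : ι → Op κ) : (∑ k, A k) p q = ∑ k, A k p q := by
    exact Matrix.sum_apply p q _ _
  rw [h, map_sum, hs]
  simp [Polynomial.eval_finsetSum]

theorem theorem1 (d : ℕ) (hd : 2 ≤ d) (m : ℕ) :
    ¬ ProbabilisticallyImplementable (State.conj : State d → State d) m := by
  rintro ⟨ε, hε, I, hI⟩
  -- Unnormalised vectors are needed: dividing `ψ_t` by its norm would destroy polynomiality in `t`.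
  have key (ψ : EuclideanSpace ℂ (Fin d)) (hψ : ψ ≠ 0) : ∃ c : ℂ,
      I.success (Op.outer (tensorVec m ψ) (tensorVec m ψ)) = c • (ketbra ψ).conj := by
    have hn : (‖ψ‖ : ℂ) ≠ 0 := by simpa using hψ
    have h1 : ‖(‖ψ‖ : ℂ)⁻¹ • ψ‖ = 1 := by
      rw [norm_smul]; simp [hψ]
    obtain ⟨c, hc⟩ := (hI _ h1).1
    obtain ⟨φ, hφ⟩ : ∃ φ, φ = (‖ψ‖ : ℂ)⁻¹ • ψ := ⟨_, rfl⟩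
    have hψφ : ψ = (‖ψ‖ : ℂ) • φ := by rw [hφ, smul_inv_smul₀ hn]
    simp only [State.pure, State.conj, ← hφ] at hc
    have hconj : (ketbra ψ).conj = ((‖ψ‖ : ℂ) ^ 2) • (ketbra φ).conj := by
      ext i j
      conv_lhs => rw [hψφ]
      simp [ketbra, Op.conj]
      ring
    refine ⟨((‖ψ‖ : ℂ) * star (‖ψ‖ : ℂ)) ^ m * c * ((‖ψ‖ : ℂ) ^ 2)⁻¹, ?_⟩
    rw [← tensorPow_ketbra, hconj]
    conv_lhs => rw [hψφ]
    rw [ketbra_smul, tensorPow_smul, map_smul, hc, smul_smul, smul_smul]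
    congr 1
    field_simp
  let i₀ : Fin d := ⟨0, by omega⟩
  let i₁ : Fin d := ⟨1, by omega⟩
  have h01 : i₀ ≠ i₁ := by simp [i₀, i₁]
  have : Nonempty (Fin m → Fin d) := ⟨fun _ => i₀⟩
  let x : Fin d → Polynomial ℂ := fun i =>
    if i = i₀ then 1 else if i = i₁ then Polynomial.X else 0
  let u : (Fin m → Fin d) → Polynomial ℂ := fun a => ∏ k, x (a k)
  let ψ : ℂ → EuclideanSpace ℂ (Fin d) := fun t => WithLp.toLp 2 fun i => (x i).eval t
  have hu (t : ℂ) : (fun a => (u a).eval t) = tensorVec m (ψ t) := by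
    ext a
    simp [u, tensorVec, ψ, Polynomial.eval_prod]
  have hψ₀ (t : ℂ) : ψ t i₀ = 1 := by simp [ψ, x]
  have hψ₁ (t : ℂ) : ψ t i₁ = t := by simp [ψ, x, h01.symm]
  have hψne (t : ℂ) : ψ t ≠ 0 := by
    intro h
    have := hψ₀ t
    simp [h] at this
  let E : Op (Fin m → Fin d) →ₗ[ℂ] Op (Fin d) := I.success.toLinearMap
  obtain ⟨P, hP⟩ := exists_polynomial_map_outer E u (tensorVec m (ψ 0)) i₀ i₀
  obtain ⟨Q, hQ⟩ := exists_polynomial_map_outer E u (tensorVec m (ψ 0)) i₁ i₀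
  have hPQ (t : ℂ) : Q.eval t = star t * P.eval t := by
    obtain ⟨c, hc⟩ := key (ψ t) (hψne t)
    -- The vector `e₁ - t e₀` is orthogonal to `ψ_t* = e₀ + conj t e₁`.
    have h := I.success.outer_row_eq_zero (tensorVec m (ψ t)) (tensorVec m (ψ 0))
      (Pi.single i₁ 1 - Pi.single i₀ t) (fun p => by
        rw [hc]
        simp [mul_sub, Finset.sum_sub_distrib, Pi.single_apply, ketbra, Op.conj, hψ₀, hψ₁]
        ring) i₀
    have hv (p : Fin d) : star ((Pi.single i₁ 1 - Pi.single i₀ t : Fin d → ℂ) p)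
        = (if p = i₁ then 1 else 0) - (if p = i₀ then star t else 0) := by
      rw [Pi.sub_apply, star_sub, Pi.single_apply, Pi.single_apply]
      congr 1 <;> split_ifs <;> simp
    simp only [hv, sub_mul, Finset.sum_sub_distrib, ite_mul, one_mul, zero_mul,
      Finset.sum_ite_eq', Finset.mem_univ, if_true] at h
    rw [hP, hQ, hu]
    exact sub_eq_zero.mp h
  have hP0 : P.eval 0 = 0 := by rw [Polynomial.eq_zero_of_eval_eq_conj_mul hPQ]; simp
  have hx (i : Fin d) (hi : i ≠ i₀) : ψ 0 i = 0 := by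
    by_cases h : i = i₁ <;> simp [ψ, x, hi, h, h01.symm]
  have h1 : ‖ψ 0‖ = 1 := by
    rw [EuclideanSpace.norm_eq, Finset.sum_eq_single i₀ (fun i _ hi => by simp [hx i hi])
      (by simp), hψ₀]
    simp
  have hle := (hI _ h1).2
  obtain ⟨c, hc⟩ := key (ψ 0) (hψne 0)
  rw [hP, hu] at hP0
  change I.success _ _ _ = 0 at hP0
  simp only [State.pure, tensorPow_ketbra] at hle
  rw [hc] at hP0 hle
  -- The output at `t = 0` is a multiple of `|e₀⟩⟨e₀|`, so its trace is the single entry `P(0)`.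
  rw [Op.tr, Finset.sum_eq_single i₀ (fun i _ hi => by simp [ketbra, Op.conj, hx i hi])
    (by simp), hP0] at hle
  simp at hle
  linarith
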